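/- Let $\alpha$ be an ordinal, and equip the ordinal $\omega^{\alpha+1}$ (the set of all ordinals below it) with its order topology. Call an element of $\omega^{\alpha+1}$ of \emph{maximal rank} if it is of the form $\omega^{\alpha}\cdot k$ for some integer $k\ge 1$, where in the case $\alpha=0$ (in which the space $\omega$ is discrete) the element $0$ is also counted as being of maximal rank. Then every homeomorphism of $\omega^{\alpha+1}$ onto itself induces a permutation of the set of maximal rank elements. Let $\mathrm{Fin}(\omega^{\alpha+1})$ be the subgroup of the group $\mathrm{Homeo}(\omega^{\alpha+1})$ of self-homeomorphisms consisting of those homeomorphisms for which this permutation is finite, i.e. moves only finitely many maximal rank elements. Then $\mathrm{Fin}(\omega^{\alpha+1})$ is a proper normal subgroup of $\mathrm{Homeo}(\omega^{\alpha+1})$, and it contains every proper normal subgroup of $\mathrm{Homeo}(\omega^{\alpha+1})$; in particular, it is the unique maximal proper normal subgroup. For $\alpha=0$ this recovers the theorem of Schreier and Ulam: the identification of $\omega$ with the set $\mathbb N=\{0,1,2,\dots\}$ induces an isomorphism $\mathrm{Homeo}(\omega)\cong\mathrm{Sym}(\mathbb N)$ that carries $\mathrm{Fin}(\omega)$ onto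 the group of permutations of $\mathbb N$ with finite support, and this group is a proper normal subgroup of $\mathrm{Sym}(\mathbb N)$ that contains every proper normal subgroup; in particular, it is the unique maximal proper normal subgroup. -/

import Mathlib

open Ordinal

universe u

/-- The ordinal `ω ^ (α + 1)`, as the set of ordinals below it. Its topology is the subspace
topology of `Ordinal`, which is the order topology since the set is an initial segment. -/
abbrev OmegaPow (α : Ordinal.{u}) : Type (u + 1) := Set.Iio (ω ^ (α + 1) : Ordinal.{u})

/-- The group of self-homeomorphisms of `ω ^ (α + 1)`, under composition. -/
abbrev HomeoOmegaPow (α : Ordinal.{u}) : Type (u + 1) := OmegaPow α ≃ₜ OmegaPow α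

/-- The maximal rank elements of `ω ^ (α + 1)`: those of the form `ω ^ α * k` with `k ≥ 1` a
natural number. For `α = 0` the space is discrete, all its points have the same rank, and
`0` belongs to the set as well. -/
def maxRank (α : Ordinal.{u}) : Set (OmegaPow α) :=
  {x | ∃ k : ℕ, (k ≠ 0 ∨ α = 0) ∧ (x : Ordinal.{u}) = ω ^ α * (k : Ordinal.{u})}

/-- `f` induces the permutation `σ` on the set `M`. -/
def InducesPerm {X : Type*} (f : X → X) (M : Set X) (σ : Equiv.Perm M) : Prop :=
  ∀ x : M, (σ x : X) = f x

/-- The group of finite permutations of `X`: those that move only finitely many points. -/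
def finPerm (X : Type*) : Subgroup (Equiv.Perm X) where
  carrier := {σ | {x | σ x ≠ x}.Finite}
  one_mem' := by simp
  mul_mem' := by
    intro σ τ hσ hτ
    refine (Set.Finite.union hσ hτ).subset fun x hx => ?_
    by_contra h
    simp only [Set.mem_union, Set.mem_ofPred_eq, not_or, not_not] at h
    exact hx (by rw [Equiv.Perm.mul_apply, h.2, h.1])
  inv_mem' := by
    intro σ hσ
    refine Set.Finite.subset hσ fun x hx h => hx ?_
    rw [Equiv.Perm.inv_eq_iff_eq, h]

/-- `Fin(ω ^ (α + 1))`: the homeomorphisms of `ω ^ (α + 1)` that induce a finite permutation on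
the set of maximal rank elements. -/
def finHomeo (α : Ordinal.{u}) : Subgroup (HomeoOmegaPow α) where
  carrier := {h | ∃ σ ∈ finPerm (maxRank α), InducesPerm h (maxRank α) σ}
  one_mem' := ⟨1, one_mem _, fun _ => rfl⟩
  mul_mem' := by
    rintro g h ⟨σ, hσ, hg⟩ ⟨τ, hτ, hh⟩
    refine ⟨σ * τ, mul_mem hσ hτ, fun x => ?_⟩
    rw [Equiv.Perm.mul_apply, hg, hh]
    rfl
  inv_mem' := by
    rintro h ⟨σ, hσ, hh⟩
    refine ⟨σ⁻¹, inv_mem hσ, fun x => ?_⟩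
    have key : (x : OmegaPow α) = h (σ⁻¹ x : maxRank α) := by
      rw [← hh (σ⁻¹ x), ← Equiv.Perm.mul_apply, mul_inv_cancel, Equiv.Perm.one_apply]
    rw [key]
    exact (h.symm_apply_apply _).symm

/-- `N` is a proper normal subgroup. -/
def IsProperNormal {G : Type*} [Group G] (N : Subgroup G) : Prop :=
  N.Normal ∧ N ≠ ⊤

/-! The ordinals enter the group theory only through `IsLayered`: the set M of maximal rank elements
is infinite, preserved by homeomorphisms and finite on compact sets, and every clopen set with
infinitely many points of M is a copy of ℕ × Y, where Y = (0, ω^α] is compact. Such sets can be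
split and interchanged like infinite subsets of ℕ; the Schreier–Ulam theorem is the case where Y is
a point.

Let N be normal and let h ∈ N move infinitely many points of M. Then h displaces a clopen set C with
C ∩ M infinite (`exists_displaced`). View C as ℤ copies of ℕ × Y. A homeomorphism f of one copy is
the commutator of the shift with "f on all nonnegative copies", and displacement by h forces this
commutator into N (`extendHom_fiberwiseHomeo_mem`). Conjugation then gives every homeomorphism that
is the identity on a clopen set which, like its complement, has infinitely many points of M
(`mem_of_fixes`). Every homeomorphism is a product of two of these (`eq_top_of_infinite_moved`).

For ordinals, invariance of M comes from Cantor–Bendixson rank (`mem_rankSet_iff`), and the shape of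
clopen sets from the absorption d + ω^α = ω^α for d < ω^α (`nonempty_sum_Ioc_homeo`). -/

/-! ### Gluing homeomorphisms along clopen partitions -/

section Gluing

variable {X Y Z W : Type*} [TopologicalSpace X] [TopologicalSpace Y] [TopologicalSpace Z]
  [TopologicalSpace W]

/-- The union of two disjoint open sets is their topological sum. -/
noncomputable def unionHomeo {A B : Set X} (hA : IsOpen A) (hB : IsOpen B) (hd : Disjoint A B) :
    A ⊕ B ≃ₜ ↥(A ∪ B) :=
  (Equiv.ofBijective
    (Sum.elim (Set.inclusion Set.subset_union_left) (Set.inclusion Set.subset_union_right)) (by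
      constructor
      · rintro (x | x) (y | y) h
        · simpa [Set.inclusion, Subtype.ext_iff] using h
        · have : (x : X) = y := by simpa [Set.inclusion] using h
          exact (Set.disjoint_left.1 hd x.2 (this ▸ y.2)).elim
        · have : (x : X) = y := by simpa [Set.inclusion] using h
          exact (Set.disjoint_left.1 hd y.2 (this ▸ x.2)).elim
        · simpa [Set.inclusion, Subtype.ext_iff] using h
      · rintro ⟨x, hx | hx⟩
        · exact ⟨Sum.inl ⟨x, hx⟩, rfl⟩
        · exact ⟨Sum.inr ⟨x, hx⟩, rfl⟩)).toHomeomorphOfContinuousOpen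
    (Continuous.sumElim (continuous_inclusion _) (continuous_inclusion _))
    (IsOpenMap.sumElim (hA.isOpenMap_inclusion _) (hB.isOpenMap_inclusion _))

/-- A clopen set splits the space as a topological sum. -/
noncomputable def complHomeo {A : Set X} (hA : IsClopen A) : A ⊕ ↥(Aᶜ) ≃ₜ X :=
  (unionHomeo hA.isOpen hA.compl.isOpen disjoint_compl_right).trans
    ((Homeomorph.setCongr (Set.union_compl_self A)).trans (Homeomorph.Set.univ X))

theorem complHomeo_inl {A : Set X} (hA : IsClopen A) (x : A) :
    complHomeo hA (Sum.inl x) = x := rfl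

theorem complHomeo_inr {A : Set X} (hA : IsClopen A) (x : ↥(Aᶜ)) :
    complHomeo hA (Sum.inr x) = x := rfl

/-- Extension by the identity of homeomorphisms of a summand of `X`. -/
def extendHom (ψ : Z ⊕ W ≃ₜ X) : (Z ≃ₜ Z) →* (X ≃ₜ X) where
  toFun f := ψ.symm.trans ((f.sumCongr (.refl W)).trans ψ)
  map_one' := by
    ext x
    obtain ⟨z | w, rfl⟩ := ψ.surjective x <;> simp <;> rfl
  map_mul' f g := by
    ext x
    obtain ⟨z | w, rfl⟩ := ψ.surjective x <;> simp <;> rfl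

@[simp] theorem extendHom_inl (ψ : Z ⊕ W ≃ₜ X) (f : Z ≃ₜ Z) (z : Z) :
    extendHom ψ f (ψ (Sum.inl z)) = ψ (Sum.inl (f z)) := by
  simp [extendHom]
  rfl

@[simp] theorem extendHom_inr (ψ : Z ⊕ W ≃ₜ X) (f : Z ≃ₜ Z) (w : W) :
    extendHom ψ f (ψ (Sum.inr w)) = ψ (Sum.inr w) := by
  simp [extendHom]
  rfl

/-- A space that maps continuously to `ℕ` with all fibres homeomorphic to `Y` is `ℕ × Y`. -/
theorem nonempty_homeo_nat_prod {φ : X → ℕ} (hφ : Continuous φ)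
    (h : ∀ n, Nonempty (↥(φ ⁻¹' {n}) ≃ₜ Y)) : Nonempty (X ≃ₜ ℕ × Y) := by
  let e : ∀ n, ↥(φ ⁻¹' {n}) ≃ₜ Y := fun n => (h n).some
  have hopen : ∀ n, IsOpen (φ ⁻¹' {n}) := fun n => (isOpen_discrete {n}).preimage hφ
  let g : ℕ × Y → X := fun p => (e p.1).symm p.2
  have hφg : ∀ p, φ (g p) = p.1 := fun p => ((e p.1).symm p.2).2
  have hcont : Continuous g :=
    continuous_prod_of_discrete_left.2 fun n => continuous_subtype_val.comp (e n).symm.continuous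
  have hmap : IsOpenMap g := by
    intro U hU
    have hg : g '' U = ⋃ n, (fun y => ((e n).symm y : X)) '' {y | (n, y) ∈ U} := by
      ext x
      simp only [Set.mem_image, Set.mem_iUnion, Prod.exists, Set.mem_ofPred_eq]
      rfl
    rw [hg]
    refine isOpen_iUnion fun n => ?_
    exact ((hopen n).isOpenMap_subtype_val.comp (e n).symm.isOpenMap) _
      (hU.preimage (Continuous.prodMk_right n))
  refine ⟨((Equiv.ofBijective g ⟨?_, fun x => ?_⟩).toHomeomorphOfContinuousOpen hcont hmap).symm⟩
  · rintro ⟨n, y⟩ ⟨m, z⟩ hp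
    obtain rfl : n = m := (hφg (n, y)).symm.trans ((congrArg φ hp).trans (hφg (m, z)))
    simpa [g, ← Subtype.ext_iff] using hp
  · exact ⟨(φ x, e (φ x) ⟨x, rfl⟩), by simp [g]⟩

end Gluing

/-! ### Spaces assembled from infinitely many copies of a compact space -/

section Abstract

variable {X Y : Type*} [TopologicalSpace X] [TopologicalSpace Y]

/-- `X` is zero-dimensional, the set `M` is infinite, meets compact sets in finite sets and is
invariant under homeomorphisms, and every clopen set with infinitely many points of `M` is
homeomorphic to `ℕ × Y`. -/
structure IsLayered (Y : Type*) [TopologicalSpace Y] (M : Set X) : Prop where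
  exists_clopen : ∀ (x : X) (U : Set X), IsOpen U → x ∈ U → ∃ V, IsClopen V ∧ x ∈ V ∧ V ⊆ U
  invariant : ∀ (g : X ≃ₜ X), ∀ x ∈ M, g x ∈ M
  finite_inter : ∀ K : Set X, IsCompact K → (K ∩ M).Finite
  infinite : M.Infinite
  homeo : ∀ A : Set X, IsClopen A → (A ∩ M).Infinite → Nonempty (A ≃ₜ ℕ × Y)

namespace IsLayered

variable {M : Set X}

/-- Comes from X ≅ ℕ × Y. Each fibre of φ has only finitely many points of M, so infinite subsets of
M can be studied through their images in ℕ. -/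
theorem exists_index [CompactSpace Y] (hM : IsLayered Y M) :
    ∃ φ : X → ℕ, Continuous φ ∧ ∀ n, IsCompact (φ ⁻¹' {n}) := by
  obtain ⟨e⟩ := hM.homeo Set.univ isClopen_univ (by simpa using hM.infinite)
  let e' : X ≃ₜ ℕ × Y := (Homeomorph.Set.univ X).symm.trans e
  refine ⟨fun x => (e' x).1, by fun_prop, fun n => ?_⟩
  have : (fun x => (e' x).1) ⁻¹' {n} = e' ⁻¹' ({n} ×ˢ Set.univ) := by
    ext x; simp
  rw [this, e'.isCompact_preimage]
  exact isCompact_singleton.prod isCompact_univ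

theorem infinite_image_inter (hM : IsLayered Y M) (g : X ≃ₜ X) {A : Set X}
    (hA : (A ∩ M).Infinite) : (g '' A ∩ M).Infinite := by
  refine (hA.image g.injective.injOn).mono ?_
  rintro _ ⟨x, hx, rfl⟩
  exact ⟨⟨x, hx.1, rfl⟩, hM.invariant g x hx.2⟩

theorem exists_split [CompactSpace Y] (hM : IsLayered Y M) {A : Set X} (hA : IsClopen A)
    (hAM : (A ∩ M).Infinite) :
    ∃ B ⊆ A, IsClopen B ∧ (B ∩ M).Infinite ∧ ((A \ B) ∩ M).Infinite := by
  obtain ⟨φ, hφ, hc⟩ := hM.exists_index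
  have hI : (φ '' (A ∩ M)).Infinite := by
    intro hfin
    refine hAM (Set.Finite.of_finite_fibers φ hfin fun n _ => ?_)
    exact (hM.finite_inter _ (hc n)).subset fun x hx => ⟨hx.2, hx.1.2⟩
  let ι := hI.natEmbedding
  have hι : ∀ n, ∃ x ∈ A ∩ M, φ x = ι n := fun n => (ι n).2
  let J : Set ℕ := Set.range fun k : ℕ => (ι (2 * k) : ℕ)
  have hinj : Function.Injective fun n : ℕ => (ι n : ℕ) :=
    Subtype.val_injective.comp ι.injective
  have hJ : ∀ k, (ι (2 * k + 1) : ℕ) ∉ J := by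
    rintro k ⟨j, hj⟩
    have := hinj hj
    omega
  have hJinf : J.Infinite := Set.infinite_range_of_injective fun a b h => by
    have := hinj h
    omega
  have hJ'inf : (Set.range fun k : ℕ => (ι (2 * k + 1) : ℕ)).Infinite :=
    Set.infinite_range_of_injective fun a b h => by
      have := hinj h
      omega
  refine ⟨A ∩ φ ⁻¹' J, Set.inter_subset_left,
    hA.inter ((isClopen_discrete J).preimage hφ), ?_, ?_⟩
  · refine Set.Infinite.of_image φ (hJinf.mono ?_)
    rintro _ ⟨k, rfl⟩
    obtain ⟨x, hx, hxk⟩ := hι (2 * k)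
    exact ⟨x, ⟨⟨hx.1, ⟨k, hxk.symm⟩⟩, hx.2⟩, hxk⟩
  · refine Set.Infinite.of_image φ (hJ'inf.mono ?_)
    rintro _ ⟨k, rfl⟩
    obtain ⟨x, hx, hxk⟩ := hι (2 * k + 1)
    exact ⟨x, ⟨⟨hx.1, fun h => hJ k (hxk ▸ h.2)⟩, hx.2⟩, hxk⟩

/-- A homeomorphism that moves infinitely many points of `M` displaces a clopen set with
infinitely many points of `M`. -/
theorem exists_displaced [CompactSpace Y] [T2Space X] (hM : IsLayered Y M) (h : X ≃ₜ X)
    (hh : {x ∈ M | h x ≠ x}.Infinite) :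
    ∃ C : Set X, IsClopen C ∧ (C ∩ M).Infinite ∧ Disjoint C (h '' C) := by
  obtain ⟨φ, hφ, hc⟩ := hM.exists_index
  have hfib : ∀ n, IsClopen (φ ⁻¹' {n}) := fun n => (isClopen_discrete {n}).preimage hφ
  -- Small displaced clopen sets are chosen one at a time. The union K of those already chosen is
  -- compact, so φ is bounded on K and on its images under h and its inverse; the next set lies
  -- around a moved point of M in a fibre avoiding all three.
  obtain ⟨V, hV, hVr⟩ := exists_seq_of_forall_finset_exists
    (fun V : Set X => IsClopen V ∧ (V ∩ M).Nonempty ∧ (∃ n, V ⊆ φ ⁻¹' {n}) ∧ Disjoint V (h '' V))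
    (fun V W => (∀ x ∈ V, ∀ y ∈ W, φ x ≠ φ y) ∧ Disjoint V (h '' W) ∧ Disjoint W (h '' V)) (by
      intro s hs
      let K : Set X := ⋃ V ∈ s, V
      have hK : IsCompact K := s.isCompact_biUnion fun V hV => by
        obtain ⟨hVc, -, ⟨n, hn⟩, -⟩ := hs V hV
        exact (hc n).of_isClosed_subset hVc.isClosed hn
      let K' : Set X := K ∪ (h '' K ∪ h.symm '' K)
      have hK' : IsCompact K' :=
        hK.union ((hK.image h.continuous).union (hK.image h.symm.continuous))
      have hfin : (φ '' K').Finite := (hK'.image hφ).finite_of_discrete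
      obtain ⟨m, ⟨hmM, hm⟩, hmK⟩ : ∃ m ∈ {x ∈ M | h x ≠ x}, φ m ∉ φ '' K' := by
        by_contra! hcon
        refine hh (Set.Finite.of_finite_fibers φ
          (hfin.subset (by rintro _ ⟨x, hx, rfl⟩; exact hcon x hx)) fun n _ => ?_)
        exact (hM.finite_inter _ (hc n)).subset fun x hx => ⟨hx.2, hx.1.1⟩
      obtain ⟨P, Q, hP, hQ, hhmP, hmQ, hPQ⟩ := t2_separation hm
      obtain ⟨W, hW, hmW, hWsub⟩ := hM.exists_clopen m (h ⁻¹' P ∩ Q ∩ φ ⁻¹' {φ m})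
        (((hP.preimage h.continuous).inter hQ).inter (hfib _).isOpen) ⟨⟨hhmP, hmQ⟩, rfl⟩
      have hWφ : ∀ x ∈ W, φ x = φ m := fun x hx => (hWsub hx).2
      have hWK : ∀ x ∈ W, x ∉ K' := fun x hx hxK => hmK ⟨x, hxK, hWφ x hx⟩
      have hVK : ∀ V ∈ s, V ⊆ K := fun V hV => Set.subset_biUnion_of_mem (u := id) hV
      refine ⟨W, ⟨hW, ⟨m, hmW, hmM⟩, ⟨φ m, hWφ⟩, ?_⟩, fun V hV => ⟨?_, ?_, ?_⟩⟩
      · rw [Set.disjoint_left]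
        rintro _ hx ⟨y, hy, rfl⟩
        exact Set.disjoint_left.1 hPQ (hWsub hy).1.1 (hWsub hx).1.2
      · intro x hx y hy hxy
        exact hmK ⟨x, Or.inl (hVK V hV hx), hxy.trans (hWφ y hy)⟩
      · rw [Set.disjoint_left]
        rintro _ hx ⟨y, hy, rfl⟩
        exact hWK y hy (Or.inr (Or.inr ⟨h y, hVK V hV hx, by simp⟩))
      · rw [Set.disjoint_left]
        rintro _ hx ⟨y, hy, rfl⟩
        exact hWK _ hx (Or.inr (Or.inl ⟨y, hVK V hV hy, rfl⟩)))
  have hne : ∀ {i j x y}, x ∈ V i → y ∈ V j → φ x = φ y → i = j := by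
    intro i j x y hx hy hxy
    rcases lt_trichotomy i j with hij | hij | hij
    · exact ((hVr i j hij).1 x hx y hy hxy).elim
    · exact hij
    · exact ((hVr j i hij).1 y hy x hx hxy.symm).elim
  refine ⟨⋃ i, V i, ⟨?_, isOpen_iUnion fun i => (hV i).1.isOpen⟩, ?_, ?_⟩
  -- The pieces lie over distinct values of φ, so a fibre, which is open, meets at most one of them.
  · refine LocallyFinite.isClosed_iUnion (fun x => ⟨φ ⁻¹' {φ x}, (hfib _).isOpen.mem_nhds rfl, ?_⟩)
      fun i => (hV i).1.isClosed
    refine Set.Subsingleton.finite ?_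
    rintro i ⟨y, hy, hyx⟩ j ⟨z, hz, hzx⟩
    exact hne hy hz (hyx.trans hzx.symm)
  · choose m hm using fun i => (hV i).2.1
    refine (Set.infinite_range_of_injective (f := m) fun i j hij => ?_).mono ?_
    · exact hne (hm i).1 (hm j).1 (by rw [hij])
    · rintro _ ⟨i, rfl⟩
      exact ⟨Set.mem_iUnion.2 ⟨i, (hm i).1⟩, (hm i).2⟩
  · rw [Set.image_iUnion, Set.disjoint_iUnion_left]
    intro i
    rw [Set.disjoint_iUnion_right]
    intro j
    rcases lt_trichotomy i j with hij | rfl | hij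
    · exact (hVr i j hij).2.1
    · exact (hV i).2.2.2
    · exact (hVr j i hij).2.2

end IsLayered

end Abstract

/-! ### Normal subgroups of homeomorphism groups -/

section Normal

variable {X Y Z W W' : Type*} [TopologicalSpace X] [TopologicalSpace Y] [TopologicalSpace Z]
  [TopologicalSpace W] [TopologicalSpace W']

/-- The two extensions are conjugate by the homeomorphism of X that matches the summands, so only
the type of the complement matters. -/
theorem extendHom_mem_of_mem {N : Subgroup (X ≃ₜ X)} [hN : N.Normal] (ψ : Z ⊕ W ≃ₜ X)
    (ψ' : Z ⊕ W' ≃ₜ X) (e : W ≃ₜ W') {f : Z ≃ₜ Z} (hf : extendHom ψ f ∈ N) :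
    extendHom ψ' f ∈ N := by
  let g : X ≃ₜ X := ψ.symm.trans (((Homeomorph.refl Z).sumCongr e).trans ψ')
  have hl : ∀ z, g (ψ (Sum.inl z)) = ψ' (Sum.inl z) := fun z => by simp [g]; rfl
  have hr : ∀ w, g (ψ (Sum.inr w)) = ψ' (Sum.inr (e w)) := fun w => by simp [g]; rfl
  have key : extendHom ψ' f = g * extendHom ψ f * g⁻¹ := by
    rw [eq_mul_inv_iff_mul_eq]
    ext x
    obtain ⟨z | w, rfl⟩ := ψ.surjective x
    · simp [hl]
    · simp [hr]
  rw [key]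
  exact hN.conj_mem _ hf g

/-- The homeomorphism of `ℤ × Z` that acts by `F n` on the `n`-th copy of `Z`. -/
def fiberwiseHomeo (F : ℤ → (Z ≃ₜ Z)) : ℤ × Z ≃ₜ ℤ × Z where
  toFun p := (p.1, F p.1 p.2)
  invFun p := (p.1, (F p.1).symm p.2)
  left_inv p := by simp
  right_inv p := by simp
  continuous_toFun := continuous_prod_of_discrete_left.2 fun n => by dsimp; fun_prop
  continuous_invFun := continuous_prod_of_discrete_left.2 fun n => by dsimp; fun_prop

/-- The homeomorphism of `ℤ × Z` that takes the `n`-th copy of `Z` to the next one. -/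
def shiftHomeo (Z : Type*) [TopologicalSpace Z] : ℤ × Z ≃ₜ ℤ × Z :=
  (Equiv.addRight (1 : ℤ)).toHomeomorphOfDiscrete.prodCongr (Homeomorph.refl Z)

theorem shiftHomeo_apply (p : ℤ × Z) : shiftHomeo Z p = (p.1 + 1, p.2) := rfl

theorem fiberwiseHomeo_apply (F : ℤ → (Z ≃ₜ Z)) (p : ℤ × Z) :
    fiberwiseHomeo F p = (p.1, F p.1 p.2) := rfl

/-- Conjugating `F⁻¹` by the shift gives f⁻¹ on the copies n ≥ 1, which cancels `F` everywhere
except at n = 0. -/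
theorem fiberwiseHomeo_commutator (f : Z ≃ₜ Z) :
    let F : ℤ × Z ≃ₜ ℤ × Z := fiberwiseHomeo fun n => if 0 ≤ n then f else 1
    F * shiftHomeo Z * F⁻¹ * (shiftHomeo Z)⁻¹ = fiberwiseHomeo fun n => if n = 0 then f else 1 := by
  intro F
  rw [mul_inv_eq_iff_eq_mul, mul_inv_eq_iff_eq_mul]
  ext1 ⟨n, z⟩
  simp only [F, Homeomorph.mul_apply, shiftHomeo_apply, fiberwiseHomeo_apply]
  rcases lt_trichotomy n (-1) with h | rfl | h
  · have h1 : ¬ 0 ≤ n + 1 := by omega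
    have h2 : ¬ 0 ≤ n := by omega
    have h3 : n + 1 ≠ 0 := by omega
    simp [h1, h2, h3]
  · simp
  · have h1 : 0 ≤ n + 1 := by omega
    have h2 : 0 ≤ n := by omega
    have h3 : n + 1 ≠ 0 := by omega
    simp [h1, h2, h3]

theorem Homeomorph.mul_comm_of_disjoint {f g : X ≃ₜ X} (h : ∀ x, f x = x ∨ g x = x) :
    f * g = g * f := by
  have : Equiv.Perm.Disjoint f.toEquiv g.toEquiv := h
  ext x
  exact DFunLike.congr_fun this.commute.eq x

/-- A normal subgroup with an element that displaces a summand `ℤ × Z` contains the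
homeomorphisms of the zeroth copy of `Z`. -/
theorem extendHom_fiberwiseHomeo_mem {N : Subgroup (X ≃ₜ X)} [hN : N.Normal] {h : X ≃ₜ X}
    (hh : h ∈ N) (Θ : (ℤ × Z) ⊕ W ≃ₜ X) (hΘ : ∀ p q, h (Θ (Sum.inl p)) ≠ Θ (Sum.inl q))
    (f : Z ≃ₜ Z) : extendHom Θ (fiberwiseHomeo fun n => if n = 0 then f else 1) ∈ N := by
  rw [← fiberwiseHomeo_commutator f]
  set F' : ℤ × Z ≃ₜ ℤ × Z := fiberwiseHomeo fun n => if 0 ≤ n then f else 1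
  simp only [map_mul, map_inv]
  set F := extendHom Θ F'
  set s := extendHom Θ (shiftHomeo Z)
  let k := h * F⁻¹ * h⁻¹
  have hFk : F * k ∈ N := by
    have : F * h * F⁻¹ * h⁻¹ ∈ N := N.mul_mem (hN.conj_mem h hh F) (N.inv_mem hh)
    simpa only [k, mul_assoc] using this
  -- The support of `k` lies in the h-image of the summand ℤ × Z and that of `s` in the summand
  -- itself; h makes these disjoint.
  have hks : k * s = s * k := by
    refine Homeomorph.mul_comm_of_disjoint fun x => ?_
    obtain ⟨y, rfl⟩ := h.surjective x
    obtain ⟨p | w, rfl⟩ := Θ.surjective y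
    · right
      obtain ⟨q | w, hq⟩ := Θ.surjective (h (Θ (Sum.inl p)))
      · exact (hΘ p q hq.symm).elim
      · rw [← hq]
        exact extendHom_inr _ _ _
    · left
      have : F⁻¹ (Θ (Sum.inr w)) = Θ (Sum.inr w) := by
        rw [← map_inv]
        exact extendHom_inr _ _ _
      simp only [k, Homeomorph.mul_apply]
      rw [Homeomorph.inv_apply h, h.symm_apply_apply, this]
  -- As `k` commutes with `s`, replacing `F` by `F * k` ∈ N does not change the commutator with `s`.
  have : F * s * F⁻¹ * s⁻¹ = (F * k) * (s * (F * k)⁻¹ * s⁻¹) := by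
    rw [mul_inv_rev]
    calc F * s * F⁻¹ * s⁻¹ = F * (s * k) * k⁻¹ * F⁻¹ * s⁻¹ := by group
      _ = F * (k * s) * k⁻¹ * F⁻¹ * s⁻¹ := by rw [hks]
      _ = _ := by group
  rw [this]
  exact N.mul_mem hFk (hN.conj_mem _ (N.inv_mem hFk) s)

/-- Splitting off the zeroth copy of `Z` in `ℤ × Z`. -/
def zeroFiberHomeo (Z : Type*) [TopologicalSpace Z] :
    Z ⊕ ({n : ℤ // ¬ n = 0} × Z) ≃ₜ ℤ × Z :=
  ((Homeomorph.uniqueProd {n : ℤ // n = 0} Z).symm.sumCongr (.refl _)).trans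
    (Homeomorph.sumProdDistrib.symm.trans
      ((Equiv.sumCompl fun n : ℤ => n = 0).toHomeomorphOfDiscrete.prodCongr (.refl Z)))

theorem extendHom_zeroFiberHomeo (Θ : (ℤ × Z) ⊕ W ≃ₜ X) (f : Z ≃ₜ Z) :
    extendHom ((Homeomorph.sumAssoc Z ({n : ℤ // ¬ n = 0} × Z) W).symm.trans
      (((zeroFiberHomeo Z).sumCongr (.refl W)).trans Θ)) f =
      extendHom Θ (fiberwiseHomeo fun n => if n = 0 then f else 1) := by
  set ψ := (Homeomorph.sumAssoc Z ({n : ℤ // ¬ n = 0} × Z) W).symm.trans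
      (((zeroFiberHomeo Z).sumCongr (.refl W)).trans Θ)
  have h1 : ∀ z, ψ (Sum.inl z) = Θ (Sum.inl (0, z)) := fun z => rfl
  have h2 : ∀ n z, ψ (Sum.inr (Sum.inl (n, z))) = Θ (Sum.inl (n.1, z)) := fun n z => rfl
  have h3 : ∀ w, ψ (Sum.inr (Sum.inr w)) = Θ (Sum.inr w) := fun z => rfl
  ext x
  obtain ⟨z | ⟨n, z⟩ | w, rfl⟩ := ψ.surjective x
  · rw [extendHom_inl, h1, h1, extendHom_inl, fiberwiseHomeo_apply]
    simp
  · rw [extendHom_inr, h2, extendHom_inl, fiberwiseHomeo_apply]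
    simp [n.2]
  · rw [extendHom_inr, h3, extendHom_inr]

namespace IsLayered

variable {M : Set X}

/-- The swindle is run on a displaced set. The complement of the zeroth copy is again ℕ × Y, so
conjugation carries the result to any decomposition `ψ`. -/
theorem extendHom_mem [CompactSpace Y] [T2Space X] (hM : IsLayered Y M) {N : Subgroup (X ≃ₜ X)}
    [N.Normal] {h : X ≃ₜ X} (hh : h ∈ N) (hinf : {x ∈ M | h x ≠ x}.Infinite)
    (ψ : (ℕ × Y) ⊕ (ℕ × Y) ≃ₜ X) (f : ℕ × Y ≃ₜ ℕ × Y) : extendHom ψ f ∈ N := by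
  obtain ⟨C, hC, hCM, hd⟩ := hM.exists_displaced h hinf
  have hC'M : (Cᶜ ∩ M).Infinite := (hM.infinite_image_inter h hCM).mono
    (Set.inter_subset_inter_left _ (Set.disjoint_right.1 hd))
  obtain ⟨a⟩ := hM.homeo C hC hCM
  obtain ⟨b⟩ := hM.homeo Cᶜ hC.compl hC'M
  obtain ⟨i⟩ : Nonempty (ℕ ≃ ℤ × ℕ) := nonempty_equiv_of_countable
  obtain ⟨j⟩ : Nonempty ({n : ℤ // ¬ n = 0} × ℕ ⊕ ℕ ≃ ℕ) := nonempty_equiv_of_countable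
  let a' : C ≃ₜ ℤ × (ℕ × Y) :=
    a.trans ((i.toHomeomorphOfDiscrete.prodCongr (.refl Y)).trans (Homeomorph.prodAssoc _ _ _))
  let Θ : (ℤ × (ℕ × Y)) ⊕ ↥(Cᶜ) ≃ₜ X := (a'.symm.sumCongr (.refl _)).trans (complHomeo hC)
  have hΘ : ∀ p, Θ (Sum.inl p) ∈ C := fun p => (a'.symm p).2
  have hmem := extendHom_fiberwiseHomeo_mem hh Θ
    (fun p q hpq => Set.disjoint_left.1 hd (hΘ q) ⟨_, hΘ p, hpq⟩) f
  rw [← extendHom_zeroFiberHomeo] at hmem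
  refine extendHom_mem_of_mem _ ψ ?_ hmem
  exact ((Homeomorph.prodAssoc _ _ _).symm.sumCongr b).trans
    (Homeomorph.sumProdDistrib.symm.trans (j.toHomeomorphOfDiscrete.prodCongr (.refl Y)))

theorem mem_of_fixes (hM : IsLayered Y M) {N : Subgroup (X ≃ₜ X)}
    (hN : ∀ (ψ : (ℕ × Y) ⊕ (ℕ × Y) ≃ₜ X) (f : ℕ × Y ≃ₜ ℕ × Y), extendHom ψ f ∈ N)
    {D : Set X} (hD : IsClopen D) (hDM : (D ∩ M).Infinite) (hD'M : (Dᶜ ∩ M).Infinite)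
    {g : X ≃ₜ X} (hg : ∀ x ∈ D, g x = x) : g ∈ N := by
  obtain ⟨b⟩ := hM.homeo D hD hDM
  obtain ⟨a⟩ := hM.homeo Dᶜ hD.compl hD'M
  let ψ : (ℕ × Y) ⊕ (ℕ × Y) ≃ₜ X :=
    (Homeomorph.sumComm _ _).trans ((b.symm.sumCongr a.symm).trans (complHomeo hD))
  have h1 : ∀ z, ψ (Sum.inl z) = a.symm z := fun _ => rfl
  have h2 : ∀ z, ψ (Sum.inr z) = b.symm z := fun _ => rfl
  have hgD : ∀ x, x ∈ Dᶜ ↔ g x ∈ Dᶜ := fun x => not_congr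
    ⟨fun hx => by rwa [hg x hx], fun hx => by rwa [← g.injective (hg _ hx)]⟩
  let f : ℕ × Y ≃ₜ ℕ × Y := a.symm.trans ((g.subtype hgD).trans a)
  have : extendHom ψ f = g := by
    ext x
    obtain ⟨z | z, rfl⟩ := ψ.surjective x
    · rw [extendHom_inl, h1, h1]
      simp [f]
    · rw [extendHom_inr, h2, hg _ (b.symm z).2]
  exact this ▸ hN ψ f

/-- Homeomorphisms between clopen sets and between their complements glue. -/
theorem exists_glue {A B : Set X} (hA : IsClopen A) (hB : IsClopen B) (a : A ≃ₜ B)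
    (b : ↥(Aᶜ) ≃ₜ ↥(Bᶜ)) :
    ∃ g : X ≃ₜ X, (∀ x : A, g x = a x) ∧ ∀ x : ↥(Aᶜ), g x = b x := by
  refine ⟨(complHomeo hA).symm.trans ((a.sumCongr b).trans (complHomeo hB)), fun x => ?_,
    fun x => ?_⟩
  · rw [← complHomeo_inl hA]
    simp
    rfl
  · rw [← complHomeo_inr hA]
    simp
    rfl

/-- Swap two complementary clopen copies of ℕ × Y. -/
theorem exists_infinite_moved [CompactSpace Y] (hM : IsLayered Y M) :
    ∃ g : X ≃ₜ X, {x ∈ M | g x ≠ x}.Infinite := by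
  obtain ⟨B, -, hB, hBM, hB'M⟩ := hM.exists_split isClopen_univ (by simpa using hM.infinite)
  rw [← Set.compl_eq_univ_sdiff] at hB'M
  obtain ⟨a⟩ := hM.homeo B hB hBM
  obtain ⟨b⟩ := hM.homeo Bᶜ hB.compl hB'M
  obtain ⟨g, hg, -⟩ := exists_glue hB hB.compl (a.trans b.symm)
    (((b.trans a.symm)).trans (Homeomorph.setCongr (compl_compl B).symm))
  refine ⟨g, hBM.mono fun x hx => ⟨hx.2, fun h => ?_⟩⟩
  have := hg ⟨x, hx.1⟩
  have h' : g x ∈ Bᶜ := by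
    rw [this]
    exact Subtype.coe_prop _
  exact h' (h.symm ▸ hx.1)

theorem exists_small [CompactSpace Y] (hM : IsLayered Y M) (g : X ≃ₜ X) :
    ∃ A : Set X, IsClopen A ∧ (A ∩ M).Infinite ∧ ((A ∪ g '' A)ᶜ ∩ M).Infinite := by
  obtain ⟨P, -, hP, hPM, hQM⟩ := hM.exists_split isClopen_univ (by simpa using hM.infinite)
  obtain ⟨A, hAP, hA, hAM, hBM⟩ := hM.exists_split hP hPM
  -- If `g '' A` covers almost all points of M outside `P`, then the image of `P \ A`, being
  -- disjoint from `g '' A`, contains only finitely many of them.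
  by_cases h : ((Set.univ \ P) \ g '' A ∩ M).Infinite
  · refine ⟨A, hA, hAM, h.mono ?_⟩
    rintro x ⟨⟨⟨-, hxP⟩, hxg⟩, hxM⟩
    refine ⟨?_, hxM⟩
    rintro (hx | hx)
    · exact hxP (hAP hx)
    · exact hxg hx
  · refine ⟨P \ A, hP.diff hA, hBM, ?_⟩
    refine (hQM.sdiff (Set.not_infinite.1 h)).mono ?_
    rintro x ⟨⟨⟨-, hxP⟩, hxM⟩, hx⟩
    refine ⟨?_, hxM⟩
    rintro (hx' | ⟨y, hy, rfl⟩)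
    · exact hxP hx'.1
    · refine hx ⟨⟨⟨trivial, hxP⟩, ?_⟩, hxM⟩
      rintro ⟨z, hz, hzy⟩
      exact hy.2 (g.injective hzy ▸ hz)

/-- A normal subgroup with an element that moves infinitely many points of `M` is everything. -/
theorem eq_top_of_infinite_moved [CompactSpace Y] [T2Space X] (hM : IsLayered Y M)
    {N : Subgroup (X ≃ₜ X)} [N.Normal] {h : X ≃ₜ X} (hh : h ∈ N)
    (hinf : {x ∈ M | h x ≠ x}.Infinite) : N = ⊤ := by
  rw [Subgroup.eq_top_iff']
  intro g
  have hN := hM.extendHom_mem hh hinf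
  obtain ⟨A, hA, hAM, hE⟩ := hM.exists_small g
  have hgA : IsClopen (g '' A) := ⟨g.isClosed_image.2 hA.isClosed, g.isOpen_image.2 hA.isOpen⟩
  obtain ⟨D, hDE, hD, hDM, hD'M⟩ := hM.exists_split (hA.union hgA).compl hE
  have hAD : Disjoint A D := Set.disjoint_left.2 fun x hx hxD => hDE hxD (Or.inl hx)
  have hgAD : Disjoint (g '' A) D := Set.disjoint_left.2 fun x hx hxD => hDE hxD (Or.inr hx)
  let a : A ≃ₜ ↥(g '' A) := g.image A
  obtain ⟨b⟩ := hM.homeo (A ∪ D)ᶜ (hA.union hD).compl (hD'M.mono (by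
    rintro x ⟨⟨hxE, hxD⟩, hxM⟩
    refine ⟨?_, hxM⟩
    rintro (hx | hx)
    exacts [hxE (Or.inl hx), hxD hx]))
  obtain ⟨c⟩ := hM.homeo (g '' A ∪ D)ᶜ (hgA.union hD).compl (hD'M.mono (by
    rintro x ⟨⟨hxE, hxD⟩, hxM⟩
    refine ⟨?_, hxM⟩
    rintro (hx | hx)
    exacts [hxE (Or.inr hx), hxD hx]))
  let U := unionHomeo hA.isOpen hD.isOpen hAD
  let V := unionHomeo hgA.isOpen hD.isOpen hgAD
  -- Here f agrees with g on `A` and is the identity on `D`. Thus f fixes `D` and f⁻¹g fixes `A`, so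
  -- both factors of g = f(f⁻¹g) lie in N.
  obtain ⟨f, hf, -⟩ := exists_glue (hA.union hD) (hgA.union hD)
    (U.symm.trans ((a.sumCongr (.refl D)).trans V)) (b.trans c.symm)
  have hfA : ∀ x ∈ A, f x = g x := fun x hx => by
    have := hf (U (Sum.inl ⟨x, hx⟩))
    rw [Homeomorph.trans_apply, Homeomorph.symm_apply_apply] at this
    exact this
  have hfD : ∀ x ∈ D, f x = x := fun x hx => by
    have := hf (U (Sum.inr ⟨x, hx⟩))
    rw [Homeomorph.trans_apply, Homeomorph.symm_apply_apply] at this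
    exact this
  have hfN : f ∈ N := hM.mem_of_fixes hN hD hDM
    (hAM.mono (Set.inter_subset_inter_left _ (Set.disjoint_left.1 hAD))) hfD
  have hfgN : f⁻¹ * g ∈ N := hM.mem_of_fixes hN hA hAM
    (hDM.mono (Set.inter_subset_inter_left _ (Set.disjoint_right.1 hAD))) fun x hx => by
      rw [Homeomorph.mul_apply, ← hfA x hx]
      exact f.symm_apply_apply x
  simpa using N.mul_mem hfN hfgN

end IsLayered

end Normal

/-! ### Divisibility by powers of `ω` and accumulation points -/

section Rank

open Filter Set.Notation

theorem omega0_opow_ne_zero (β : Ordinal.{u}) : (ω ^ β : Ordinal.{u}) ≠ 0 :=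
  (opow_pos β omega0_pos).ne'

/-- The remainder of y modulo ω^β is absorbed, so y + ω^β is the first multiple of ω^β above y. -/
theorem add_omega0_opow_eq (y β : Ordinal.{u}) :
    y + ω ^ β = ω ^ β * (y / ω ^ β + 1) := by
  conv_lhs => rw [← Ordinal.div_add_mod y (ω ^ β)]
  rw [add_assoc, add_omega0_opow (Ordinal.mod_lt y (omega0_opow_ne_zero β)), mul_add_one]

theorem omega0_opow_dvd_iff {β x : Ordinal.{u}} :
    ω ^ β ∣ x ↔ ∀ y < x, y + ω ^ β ≤ x := by
  constructor
  · rintro ⟨q, rfl⟩ y hy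
    rw [add_omega0_opow_eq]
    gcongr
    rw [Order.add_one_le_iff]
    exact (Ordinal.lt_mul_iff_div_lt (omega0_opow_ne_zero β)).1 hy
  · intro h
    by_contra hx
    have hmod : x % ω ^ β ≠ 0 := fun h0 => hx (Ordinal.dvd_of_mod_eq_zero h0)
    have hlt : ω ^ β * (x / ω ^ β) < x := by
      conv_rhs => rw [← Ordinal.div_add_mod x (ω ^ β)]
      exact lt_add_of_pos_right _ (pos_iff_ne_zero.2 hmod)
    exact (h _ hlt).not_gt (Ordinal.lt_mul_div_add x (omega0_opow_ne_zero β))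

/-- The ordinals of Cantor–Bendixson rank at least `β`. -/
def rankSet (β : Ordinal.{u}) : Set Ordinal.{u} := {x | (x ≠ 0 ∨ β = 0) ∧ ω ^ β ∣ x}

theorem accPt_ordinal_iff {x : Ordinal.{u}} {S : Set Ordinal.{u}} :
    AccPt x (𝓟 S) ↔ x ≠ 0 ∧ ∀ p < x, (S ∩ Set.Ioo p x).Nonempty := by
  apply SuccOrder.accPt_principal.trans
  simp

/-- This makes rank topological. If ω^β divides x > p, then p + ω^γ < p + ω^β ≤ x for γ < β.
Conversely, accumulation of rank γ points at x allows steps of length ω^γ to be repeated below x,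
and the ordinals ω^γ · n are cofinal in ω^β. -/
theorem mem_rankSet_iff {β x : Ordinal.{u}} (hβ : β ≠ 0) :
    x ∈ rankSet β ↔ ∀ γ < β, AccPt x (𝓟 (rankSet γ)) := by
  simp only [accPt_ordinal_iff]
  constructor
  · rintro ⟨hx, hdvd⟩ γ hγ
    refine ⟨hx.resolve_right hβ, fun p hp => ⟨p + ω ^ γ, ⟨Or.inl ?_, ?_⟩, ?_, ?_⟩⟩
    · exact (lt_of_lt_of_le (opow_pos γ omega0_pos) le_add_self).ne'
    · rw [add_omega0_opow_eq]
      exact dvd_mul_right _ _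
    · exact lt_add_of_pos_right _ (opow_pos γ omega0_pos)
    · refine lt_of_lt_of_le ?_ (omega0_opow_dvd_iff.1 hdvd p hp)
      gcongr
      exact (opow_lt_opow_iff_right one_lt_omega0).2 hγ
  · intro h
    refine ⟨Or.inl (h 0 (pos_iff_ne_zero.2 hβ)).1, omega0_opow_dvd_iff.2 fun y hy => ?_⟩
    have step : ∀ γ < β, ∀ y < x, y + ω ^ γ < x := by
      intro γ hγ y hy
      obtain ⟨z, hz, hyz, hzx⟩ := (h γ hγ).2 y hy
      exact (omega0_opow_dvd_iff.1 hz.2 y hyz).trans_lt hzx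
    have steps : ∀ γ < β, ∀ n : ℕ, y + ω ^ γ * n < x := by
      intro γ hγ n
      induction n with
      | zero => simpa using hy
      | succ n ih =>
        rw [Nat.cast_add_one, mul_add_one, ← add_assoc]
        exact step γ hγ _ ih
    rw [Ordinal.add_le_iff (omega0_opow_ne_zero β)]
    intro d hd
    obtain ⟨γ, hγ, n, hn⟩ := (lt_omega0_opow hβ).1 hd
    exact lt_trans (by gcongr) (steps γ hγ n)

theorem rankSet_zero : rankSet.{u} 0 = Set.univ := by
  ext x
  simp [rankSet]

theorem homeo_mem_rankSet {o : Ordinal.{u}} (β : Ordinal.{u}) (h : Set.Iio o ≃ₜ Set.Iio o)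
    (x : Set.Iio o) (hx : (x : Ordinal.{u}) ∈ rankSet β) : (h x : Ordinal.{u}) ∈ rankSet β := by
  induction β using WellFoundedLT.induction generalizing x with
  | ind β ih =>
    rcases eq_or_ne β 0 with rfl | hβ
    · simp [rankSet_zero]
    rw [mem_rankSet_iff hβ] at hx ⊢
    intro γ hγ
    -- The initial segment is open, so accumulation in it agrees with accumulation among all
    -- ordinals.
    have hacc : ∀ z : Set.Iio o, AccPt (z : Ordinal.{u}) (𝓟 (rankSet γ)) ↔
        AccPt z (𝓟 (Set.Iio o ↓∩ rankSet γ)) := fun z => by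
      rw [← comap_principal, isOpen_Iio.isOpenEmbedding_subtypeVal.accPt_comap_iff]
    have := (((hacc x).1 (hx γ hγ)).map h.continuous.continuousAt h.injective)
    rw [hacc]
    refine this.mono ?_
    rw [map_principal, principal_mono]
    rintro _ ⟨z, hz, rfl⟩
    exact ih γ hγ z hz

end Rank

/-! ### Maximal rank elements and clopen sets of ω^(α+1) -/

section OmegaPow

variable {α : Ordinal.{u}}

theorem lt_omega0_opow_mul_nat {x : Ordinal.{u}} (hx : x < ω ^ (α + 1)) :
    ∃ n : ℕ, x < ω ^ α * n :=
  lt_omega0_opow_succ.1 hx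

theorem omega0_opow_mul_nat_lt (n : ℕ) : ω ^ α * (n : Ordinal.{u}) < ω ^ (α + 1) :=
  opow_mul_lt_opow (natCast_lt_omega0 n) (lt_add_one α)

theorem mem_maxRank_iff {x : OmegaPow α} : x ∈ maxRank α ↔ (x : Ordinal.{u}) ∈ rankSet α := by
  constructor
  · rintro ⟨k, hk, hx⟩
    refine ⟨hk.imp_left fun hk h => ?_, hx ▸ dvd_mul_right _ _⟩
    rw [hx, mul_eq_zero] at h
    exact h.elim (omega0_opow_ne_zero α) (by exact_mod_cast hk)
  · rintro ⟨h0, q, hq⟩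
    obtain ⟨n, hn⟩ := lt_omega0_opow_mul_nat x.2
    rw [hq, mul_lt_mul_iff_right₀ (opow_pos α omega0_pos)] at hn
    obtain ⟨k, rfl⟩ := lt_omega0.1 (hn.trans (natCast_lt_omega0 n))
    refine ⟨k, h0.imp_left fun h0 hk => h0 ?_, hq⟩
    simp [hq, hk]

theorem homeo_mem_maxRank (h : HomeoOmegaPow α) {x : OmegaPow α} (hx : x ∈ maxRank α) :
    h x ∈ maxRank α :=
  mem_maxRank_iff.2 (homeo_mem_rankSet α h x (mem_maxRank_iff.1 hx))

theorem finite_Iic_inter_maxRank (x : OmegaPow α) : (Set.Iic x ∩ maxRank α).Finite := by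
  obtain ⟨n, hn⟩ := lt_omega0_opow_mul_nat x.2
  refine ((Set.finite_Iio n).image
    fun k : ℕ => (⟨ω ^ α * k, omega0_opow_mul_nat_lt k⟩ : OmegaPow α)).subset ?_
  rintro y ⟨hyx, k, -, hk⟩
  have hlt : (y : Ordinal.{u}) < ω ^ α * n := lt_of_le_of_lt hyx hn
  rw [hk, mul_lt_mul_iff_right₀ (opow_pos α omega0_pos)] at hlt
  exact ⟨k, by exact_mod_cast hlt, Subtype.ext hk.symm⟩

theorem countable_maxRank : (maxRank α).Countable := by
  refine (Set.countable_range
    fun k : ℕ => (⟨ω ^ α * k, omega0_opow_mul_nat_lt k⟩ : OmegaPow α)).mono ?_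
  rintro y ⟨k, -, hk⟩
  exact ⟨k, Subtype.ext hk.symm⟩

theorem infinite_maxRank : (maxRank α).Infinite := by
  refine (Set.infinite_range_of_injective (f := fun k : ℕ =>
    (⟨ω ^ α * (k + 1 : ℕ), omega0_opow_mul_nat_lt _⟩ : OmegaPow α)) fun a b hab => ?_).mono ?_
  · have := congrArg Subtype.val hab
    simpa [omega0_opow_ne_zero] using this
  · rintro _ ⟨k, rfl⟩
    exact ⟨k + 1, Or.inl (by simp), rfl⟩

instance : Nonempty (OmegaPow α) := ⟨⟨0, opow_pos _ omega0_pos⟩⟩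

theorem finite_inter_maxRank {K : Set (OmegaPow α)} (hK : IsCompact K) :
    (K ∩ maxRank α).Finite := by
  obtain ⟨x, hx⟩ := hK.bddAbove
  exact (finite_Iic_inter_maxRank x).subset (Set.inter_subset_inter_left _ hx)

theorem isClopen_Iic_ordinal (a : Ordinal.{u}) : IsClopen (Set.Iic a) :=
  ⟨isClosed_Iic, by
    have : Set.Iic a = Set.Iio (a + 1) := by
      ext x
      simp
    rw [this]
    exact isOpen_Iio⟩

theorem isClopen_Iic_omegaPow (a : OmegaPow α) : IsClopen (Set.Iic a) :=
  (isClopen_Iic_ordinal (a : Ordinal.{u})).preimage continuous_subtype_val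

theorem isClopen_Ioc_ordinal (a b : Ordinal.{u}) : IsClopen (Set.Ioc a b) := by
  rw [← Set.Iic_sdiff_Iic]
  exact (isClopen_Iic_ordinal b).diff (isClopen_Iic_ordinal a)

theorem isClopen_Ioc_omegaPow (a b : OmegaPow α) : IsClopen (Set.Ioc a b) :=
  (isClopen_Ioc_ordinal (a : Ordinal.{u}) b).preimage continuous_subtype_val

theorem Iic_eq_singleton {x : OmegaPow α} (hx : (x : Ordinal.{u}) = 0) : Set.Iic x = {x} := by
  ext y
  constructor
  · intro hy
    have hy' : (y : Ordinal.{u}) ≤ x := hy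
    exact Subtype.ext (by rw [hx] at hy' ⊢; simpa using hy')
  · rintro rfl
    exact Set.mem_Iic.2 le_rfl

theorem exists_Ioc_subset {x : OmegaPow α} (hx : (x : Ordinal.{u}) ≠ 0) {U : Set (OmegaPow α)}
    (hU : IsOpen U) (hxU : x ∈ U) : ∃ y < x, Set.Ioc y x ⊆ U :=
  exists_Ioc_subset_of_mem_nhds (hU.mem_nhds hxU)
    ⟨⟨0, opow_pos _ omega0_pos⟩, pos_iff_ne_zero.2 hx⟩

theorem exists_clopen_omegaPow (x : OmegaPow α) (U : Set (OmegaPow α)) (hU : IsOpen U)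
    (hx : x ∈ U) : ∃ V, IsClopen V ∧ x ∈ V ∧ V ⊆ U := by
  by_cases h0 : (x : Ordinal.{u}) = 0
  · exact ⟨Set.Iic x, isClopen_Iic_omegaPow x, Set.mem_Iic.2 le_rfl, by simpa [Iic_eq_singleton h0] using hx⟩
  · obtain ⟨y, hy, hyU⟩ := exists_Ioc_subset h0 hU hx
    exact ⟨Set.Ioc y x, isClopen_Ioc_omegaPow y x, ⟨hy, le_rfl⟩, hyU⟩

/-! ### Absorbing clopen sets -/

theorem nonempty_Ioc_add_homeo (a c : Ordinal.{u}) :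
    Nonempty (Set.Ioc a (a + c) ≃ₜ Set.Ioc 0 c) := by
  let e : Set.Ioc 0 c ≃o Set.Ioc a (a + c) :=
    { toFun := fun x => ⟨a + x, lt_add_of_pos_right a x.2.1, by gcongr; exact x.2.2⟩
      invFun := fun y => ⟨y - a, pos_iff_ne_zero.2 (Ordinal.sub_ne_zero_iff_lt.2 y.2.1),
        Ordinal.sub_le.2 y.2.2⟩
      left_inv := fun x => by simp
      right_inv := fun y => by
        simpa [Subtype.ext_iff] using Ordinal.add_sub_cancel_of_le y.2.1.le
      map_rel_iff' := by simp [← Subtype.coe_le_coe] }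
  exact ⟨e.toHomeomorph.symm⟩

theorem nonempty_Ioc_omegaPow_homeo {y x : OmegaPow α} {c : Ordinal.{u}}
    (h : (x : Ordinal.{u}) = y + c) : Nonempty (Set.Ioc y x ≃ₜ Set.Ioc 0 c) := by
  obtain ⟨e⟩ := nonempty_Ioc_add_homeo (y : Ordinal.{u}) c
  rw [← h] at e
  let e' : Set.Ioc y x ≃o Set.Ioc (y : Ordinal.{u}) x :=
    { toFun := fun z => ⟨z, z.2.1, z.2.2⟩
      invFun := fun z => ⟨⟨z, lt_of_le_of_lt z.2.2 x.2⟩, z.2.1, z.2.2⟩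
      left_inv := fun _ => rfl
      right_inv := fun _ => rfl
      map_rel_iff' := Iff.rfl }
  exact ⟨e'.toHomeomorph.trans e⟩

/-- Topological form of d + ω^α = ω^α: cut (0, ω^α] at d; the upper part has order type that of (0,
ω^α] again. -/
theorem nonempty_sum_Ioc_homeo {d : Ordinal.{u}} (hd : d < ω ^ α) :
    Nonempty (Set.Ioc 0 d ⊕ Set.Ioc 0 (ω ^ α) ≃ₜ Set.Ioc 0 (ω ^ α)) := by
  obtain ⟨e⟩ := nonempty_Ioc_add_homeo d (ω ^ α)
  rw [add_omega0_opow hd] at e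
  have hdisj : Disjoint (Set.Ioc 0 d) (Set.Ioc d (ω ^ α)) :=
    Set.disjoint_left.2 fun x hx hx' => hx.2.not_gt hx'.1
  exact ⟨((Homeomorph.refl _).sumCongr e.symm).trans
    ((unionHomeo (isClopen_Ioc_ordinal _ _).isOpen (isClopen_Ioc_ordinal _ _).isOpen hdisj).trans
      (Homeomorph.setCongr (Set.Ioc_union_Ioc_eq_Ioc zero_le hd.le)))⟩

theorem lt_add_of_Ioc_disjoint_maxRank {y x : OmegaPow α}
    (h : Disjoint (Set.Ioc y x) (maxRank α)) : (x : Ordinal.{u}) < y + ω ^ α := by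
  by_contra! hle
  let z : OmegaPow α := ⟨y + ω ^ α, lt_of_le_of_lt hle x.2⟩
  refine Set.disjoint_left.1 h (show z ∈ Set.Ioc y x from ⟨lt_add_of_pos_right (y : Ordinal.{u}) (opow_pos α omega0_pos), hle⟩) ?_
  rw [mem_maxRank_iff]
  refine ⟨Or.inl (lt_of_lt_of_le (opow_pos α omega0_pos) le_add_self).ne', ?_⟩
  simp only [z, add_omega0_opow_eq]
  exact dvd_mul_right _ _

/-- Descent on the bound x. If x ∈ U is nonzero, some (y, x] ⊆ U has no maximal rank point, hence
length below ω^α, and is absorbed; what is left lies below y. If x ∉ U, a neighbourhood of x misses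
U and the bound drops. -/
theorem nonempty_sum_homeo_of_disjoint_maxRank (hα : α ≠ 0) (x : OmegaPow α)
    (U : Set (OmegaPow α)) (hU : IsClopen U) (hUx : U ⊆ Set.Iic x) (hUM : Disjoint U (maxRank α)) :
    Nonempty (U ⊕ Set.Ioc 0 (ω ^ α) ≃ₜ Set.Ioc 0 (ω ^ α)) := by
  induction x using WellFoundedLT.induction generalizing U with
  | ind x ih =>
    by_cases hxU : x ∈ U
    · by_cases hx0 : (x : Ordinal.{u}) = 0
      · obtain rfl : U = {x} := by
          rw [Iic_eq_singleton hx0] at hUx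
          exact hUx.antisymm (by simpa using hxU)
        -- The single point 0 is absorbed as (0, 1]; 1 < ω^α needs α ≠ 0.
        obtain ⟨e⟩ := nonempty_sum_Ioc_homeo (α := α) (d := 1)
          (one_lt_opow.2 ⟨one_lt_omega0, hα⟩)
        have : Unique (Set.Ioc (0 : Ordinal.{u}) 1) :=
          { default := ⟨1, zero_lt_one, le_rfl⟩
            uniq := fun y => Subtype.ext
              (le_antisymm y.2.2 (Order.one_le_iff_pos.2 y.2.1)) }
        exact ⟨((Homeomorph.homeomorphOfUnique _ _).sumCongr (.refl _)).trans e⟩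
      · obtain ⟨y, hy, hyU⟩ := exists_Ioc_subset hx0 hU.isOpen hxU
        have hlt := lt_add_of_Ioc_disjoint_maxRank (hUM.mono_left hyU)
        obtain ⟨e₁⟩ := ih y hy (U ∩ Set.Iic y) (hU.inter (isClopen_Iic_omegaPow y))
          Set.inter_subset_right (hUM.mono_left Set.inter_subset_left)
        have hyx : (y : Ordinal.{u}) ≤ x := hy.le
        obtain ⟨e₂⟩ := nonempty_Ioc_omegaPow_homeo (Ordinal.add_sub_cancel_of_le hyx).symm
        obtain ⟨e₃⟩ := nonempty_sum_Ioc_homeo ((Ordinal.sub_lt_of_le hyx).2 hlt)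
        have hdisj : Disjoint (U ∩ Set.Iic y) (Set.Ioc y x) :=
          Set.disjoint_left.2 fun z hz hz' => hz'.1.not_ge hz.2
        have hunion : U = U ∩ Set.Iic y ∪ Set.Ioc y x := by
          ext z
          constructor
          · intro hz
            rcases le_or_gt z y with hzy | hzy
            exacts [Or.inl ⟨hz, hzy⟩, Or.inr ⟨hzy, hUx hz⟩]
          · rintro (hz | hz)
            exacts [hz.1, hyU hz]
        let s := (Homeomorph.setCongr hunion).trans
          (unionHomeo (hU.inter (isClopen_Iic_omegaPow y)).isOpen
            (isClopen_Ioc_omegaPow y x).isOpen hdisj).symm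
        exact ⟨(s.sumCongr (.refl _)).trans ((Homeomorph.sumAssoc _ _ _).trans
          (((Homeomorph.refl _).sumCongr ((e₂.sumCongr (.refl _)).trans e₃)).trans e₁))⟩
    · by_cases hx0 : (x : Ordinal.{u}) = 0
      · have : IsEmpty U := ⟨fun z => hxU (by
          have := hUx z.2
          rw [Iic_eq_singleton hx0] at this
          exact (Set.mem_singleton_iff.1 this) ▸ z.2)⟩
        exact ⟨Homeomorph.emptySum _ _⟩
      · obtain ⟨y, hy, hyU⟩ := exists_Ioc_subset hx0 hU.compl.isOpen hxU
        refine ih y hy U hU (fun z hz => ?_) hUM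
        by_contra hzy
        exact hyU ⟨not_le.1 hzy, hUx hz⟩ hz

/-- A clopen set whose only point of maximal rank is its last point. -/
theorem nonempty_homeo_of_unique_maxRank (hα : α ≠ 0) {B : Set (OmegaPow α)} (hB : IsClopen B)
    {m : OmegaPow α} (hm : m ∈ maxRank α) (hmB : m ∈ B) (hBm : B ⊆ Set.Iic m)
    (huniq : ∀ x ∈ B, x ∈ maxRank α → x = m) : Nonempty (B ≃ₜ Set.Ioc 0 (ω ^ α)) := by
  have hm' := mem_maxRank_iff.1 hm
  have hm0 : (m : Ordinal.{u}) ≠ 0 := hm'.1.resolve_right hα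
  obtain ⟨y, hy, hyB⟩ := exists_Ioc_subset hm0 hB.isOpen hmB
  obtain ⟨k, hk, hmk⟩ := hm
  obtain ⟨j, rfl⟩ := Nat.exists_eq_succ_of_ne_zero (hk.resolve_right hα)
  have hjm : ω ^ α * (j : Ordinal.{u}) < m := by
    rw [hmk]
    gcongr
    · exact opow_pos α omega0_pos
    · exact_mod_cast j.lt_succ_self
  -- Cutting at or above the preceding multiple of ω^α gives m = c + ω^α, so (c, m] is a full copy
  -- of (0, ω^α]; the rest of B has no maximal rank point and is absorbed.
  let c : OmegaPow α := max y ⟨ω ^ α * j, omega0_opow_mul_nat_lt j⟩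
  have hcm : c < m := max_lt hy hjm
  have hcB : Set.Ioc c m ⊆ B := (Set.Ioc_subset_Ioc_left (le_max_left _ _)).trans hyB
  have hjc : ω ^ α * (j : Ordinal.{u}) ≤ c :=
    le_max_right y (⟨ω ^ α * j, omega0_opow_mul_nat_lt j⟩ : OmegaPow α)
  have hmc : (m : Ordinal.{u}) = c + ω ^ α := by
    refine le_antisymm ?_ (omega0_opow_dvd_iff.1 hm'.2 c hcm)
    rw [hmk, Nat.cast_succ, mul_add_one]
    gcongr
  obtain ⟨e₁⟩ := nonempty_Ioc_omegaPow_homeo hmc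
  have hUc : IsClopen (B ∩ Set.Iic c) := hB.inter (isClopen_Iic_omegaPow c)
  obtain ⟨e₂⟩ := nonempty_sum_homeo_of_disjoint_maxRank hα c (B ∩ Set.Iic c) hUc
    Set.inter_subset_right (Set.disjoint_left.2 fun x hx hxM =>
      (hx.2.trans_lt hcm).ne (huniq x hx.1 hxM))
  have hdisj : Disjoint (B ∩ Set.Iic c) (Set.Ioc c m) :=
    Set.disjoint_left.2 fun z hz hz' => hz'.1.not_ge hz.2
  have hunion : B = B ∩ Set.Iic c ∪ Set.Ioc c m := by
    ext z
    constructor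
    · intro hz
      rcases le_or_gt z c with hzy | hzy
      exacts [Or.inl ⟨hz, hzy⟩, Or.inr ⟨hzy, hBm hz⟩]
    · rintro (hz | hz)
      exacts [hz.1, hcB hz]
  exact ⟨(Homeomorph.setCongr hunion).trans
    ((unionHomeo hUc.isOpen (isClopen_Ioc_omegaPow c m).isOpen hdisj).symm.trans
      (((Homeomorph.refl _).sumCongr e₁).trans e₂))⟩

/-- Cut `A` just after each of its maximal rank points: x belongs to the piece of the least such
point `next x` ≥ x. That point exists because only finitely many maximal rank points lie below x. -/
theorem nonempty_homeo_nat_prod_of_ne_zero (hα : α ≠ 0) {A : Set (OmegaPow α)} (hA : IsClopen A)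
    (hAM : (A ∩ maxRank α).Infinite) : Nonempty (A ≃ₜ ℕ × Set.Ioc 0 (ω ^ α)) := by
  set S := A ∩ maxRank α
  have : Infinite S := hAM.to_subtype
  have : Countable S := (countable_maxRank.mono Set.inter_subset_right).to_subtype
  obtain ⟨e⟩ : Nonempty (S ≃ ℕ) := nonempty_equiv_of_countable
  have hex : ∀ x : A, ∃ m : S, x.1 ≤ m ∧ ∀ m' : S, x.1 ≤ m' → m ≤ m' := by
    intro x
    have hne : {m : S | x.1 ≤ m}.Nonempty := by
      by_contra hcon
      refine hAM ((finite_Iic_inter_maxRank x.1).subset fun m hm => ⟨?_, hm.2⟩)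
      by_contra hlt
      exact hcon ⟨⟨m, hm⟩, show x.1 ≤ m from (not_le.1 hlt).le⟩
    obtain ⟨m, hm, hmin⟩ := WellFounded.has_min (wellFounded_lt (α := S)) _ hne
    exact ⟨m, hm, fun m' hm' => not_lt.1 (hmin m' hm')⟩
  choose next hle hmin using hex
  let B : S → Set (OmegaPow α) := fun m =>
    A ∩ Set.Iic m.1 ∩ ⋂ m' ∈ S ∩ Set.Iio m.1, (Set.Iic m')ᶜ
  -- Only finitely many points of `S` precede m, so the intersection is finite.
  have hB : ∀ m, IsClopen (B m) := fun m => by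
    refine (hA.inter (isClopen_Iic_omegaPow _)).inter
      (Set.Finite.isClopen_biInter ?_ fun m' _ => (isClopen_Iic_omegaPow m').compl)
    exact (finite_Iic_inter_maxRank m.1).subset fun z hz => ⟨Set.mem_Iic.2 (Set.mem_Iio.1 hz.2).le, hz.1.2⟩
  have hmemB : ∀ {m x}, x ∈ B m ↔ (x ∈ A ∧ x ≤ m) ∧ ∀ m' ∈ S, m' < m.1 → m' < x := by
    intro m x
    simp [B]
  have hnext : ∀ (x : A) (m : S), next x = m ↔ x.1 ∈ B m := by
    intro x m
    rw [hmemB]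
    constructor
    · rintro rfl
      refine ⟨⟨x.2, hle x⟩, fun m' hm' hlt => ?_⟩
      by_contra hcon
      exact (hmin x ⟨m', hm'⟩ (not_lt.1 hcon)).not_gt hlt
    · rintro ⟨⟨-, hxm⟩, h⟩
      refine le_antisymm (hmin x m hxm) ?_
      by_contra hcon
      exact (h _ (next x).2 (not_le.1 hcon)).not_ge (hle x)
  have hpre : ∀ (n : ℕ) (x : A), e (next x) = n ↔ x.1 ∈ B (e.symm n) := fun n x => by
    rw [← hnext, Equiv.eq_symm_apply]
  refine nonempty_homeo_nat_prod (φ := fun x : A => e (next x))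
    (continuous_discrete_rng.2 fun n => ?_) fun n => ?_
  · have : (fun x : A => e (next x)) ⁻¹' {n} = Subtype.val ⁻¹' B (e.symm n) := by
      ext x
      exact hpre n x
    rw [this]
    exact (hB _).isOpen.preimage continuous_subtype_val
  · obtain ⟨g⟩ := nonempty_homeo_of_unique_maxRank hα (hB (e.symm n)) (e.symm n).2.2
      (hmemB.2 ⟨⟨(e.symm n).2.1, le_rfl⟩, fun _ _ h => h⟩) (fun x hx => (hmemB.1 hx).1.2)
      (fun x hx hxM => by
        have hx' := hmemB.1 hx
        by_contra hne
        exact lt_irrefl x (hx'.2 x ⟨hx'.1.1, hxM⟩ (lt_of_le_of_ne hx'.1.2 hne)))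
    let r : ↥((fun x : A => e (next x)) ⁻¹' {n}) ≃ₜ B (e.symm n) :=
      { toFun := fun x => ⟨x.1.1, (hpre n x.1).1 x.2⟩
        invFun := fun x => ⟨⟨x.1, (hmemB.1 x.2).1.1⟩, (hpre n _).2 x.2⟩
        left_inv := fun _ => rfl
        right_inv := fun _ => rfl
        continuous_toFun := by fun_prop
        continuous_invFun := by fun_prop }
    exact ⟨r.trans g⟩

theorem maxRank_zero : maxRank (0 : Ordinal.{u}) = Set.univ := by
  ext x
  simp [mem_maxRank_iff, rankSet_zero]

/-- For α = 0 every point has maximal rank, so initial segments are finite, hence closed. -/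
instance discreteTopology_omegaPow_zero : DiscreteTopology (OmegaPow (0 : Ordinal.{u})) := by
  refine discreteTopology_iff_isOpen_singleton.2 fun x => ?_
  have hfin : (Set.Iio x).Finite := by
    refine (finite_Iic_inter_maxRank x).subset fun y hy => ⟨Set.mem_Iic.2 (Set.mem_Iio.1 hy).le, ?_⟩
    simp [maxRank_zero]
  rw [← Set.Iic_sdiff_Iio_same]
  exact (isClopen_Iic_omegaPow x).isOpen.sdiff hfin.isClosed

/-- Here ω^0 = 1 and (0, 1] is a single point, so only countability matters. -/
theorem nonempty_homeo_nat_prod_zero {A : Set (OmegaPow (0 : Ordinal.{u}))} (hA : A.Infinite) :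
    Nonempty (A ≃ₜ ℕ × Set.Ioc (0 : Ordinal.{u}) (ω ^ (0 : Ordinal.{u}))) := by
  have : Infinite A := hA.to_subtype
  have : Countable A := ((countable_maxRank (α := 0)).mono (by simp [maxRank_zero])).to_subtype
  obtain ⟨e⟩ : Nonempty (A ≃ ℕ) := nonempty_equiv_of_countable
  have : Unique (Set.Ioc (0 : Ordinal.{u}) (ω ^ (0 : Ordinal.{u}))) :=
    { default := ⟨1, zero_lt_one, by simp⟩
      uniq := fun y => Subtype.ext
        (le_antisymm (by simpa using y.2.2) (Order.one_le_iff_pos.2 y.2.1)) }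
  exact ⟨e.toHomeomorphOfDiscrete.trans (Homeomorph.prodUnique _ _).symm⟩

theorem isLayered_maxRank (α : Ordinal.{u}) : IsLayered (Set.Ioc 0 (ω ^ α)) (maxRank α) where
  exists_clopen := exists_clopen_omegaPow
  invariant h _ hx := homeo_mem_maxRank h hx
  finite_inter _ hK := finite_inter_maxRank hK
  infinite := infinite_maxRank
  homeo A hA hAM := by
    rcases eq_or_ne α 0 with rfl | hα
    · exact nonempty_homeo_nat_prod_zero (hAM.mono Set.inter_subset_left)
    · exact nonempty_homeo_nat_prod_of_ne_zero hα hA hAM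

instance compactSpace_Ioc_zero (c : Ordinal.{u}) : CompactSpace (Set.Ioc 0 c) := by
  rw [← isCompact_iff_compactSpace]
  exact (isCompact_Icc (a := 0) (b := c)).of_isClosed_subset (isClopen_Ioc_ordinal 0 c).isClosed
    Set.Ioc_subset_Icc_self

end OmegaPow

/-! ### The largest proper normal subgroup -/

section Largest

theorem maximal_isProperNormal_iff {G : Type*} [Group G] {F : Subgroup G} (hF : IsProperNormal F)
    (hmax : ∀ N : Subgroup G, IsProperNormal N → N ≤ F) (N : Subgroup G) :
    Maximal IsProperNormal N ↔ N = F := by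
  constructor
  · intro hN
    exact hN.eq_of_le hF (hmax N hN.prop)
  · rintro rfl
    exact ⟨hF, fun K hK _ => hmax K hK⟩

theorem IsProperNormal.map_equiv {G H : Type*} [Group G] [Group H] (e : G ≃* H) {N : Subgroup G}
    (hN : IsProperNormal N) : IsProperNormal (N.map e.toMonoidHom) := by
  refine ⟨hN.1.map _ e.surjective, fun h => hN.2 ?_⟩
  rw [Subgroup.eq_top_iff'] at h ⊢
  intro x
  obtain ⟨y, hy, hyx⟩ := h (e x)
  exact e.injective hyx ▸ hy

variable {α : Ordinal.{u}}

theorem exists_inducesPerm (h : HomeoOmegaPow α) :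
    ∃ σ : Equiv.Perm (maxRank α), InducesPerm h (maxRank α) σ :=
  ⟨h.toEquiv.subtypeEquiv fun x => ⟨homeo_mem_maxRank h, fun hx => by
    simpa using homeo_mem_maxRank h.symm hx⟩, fun _ => rfl⟩

/-- Removes the chosen permutation, giving the form in which `IsLayered` results apply. -/
theorem mem_finHomeo_iff {h : HomeoOmegaPow α} :
    h ∈ finHomeo α ↔ {x ∈ maxRank α | h x ≠ x}.Finite := by
  have key : ∀ σ : Equiv.Perm (maxRank α), InducesPerm h (maxRank α) σ →
      {x ∈ maxRank α | h x ≠ x} = Subtype.val '' {x | σ x ≠ x} := by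
    intro σ hσ
    ext x
    constructor
    · rintro ⟨hx, hne⟩
      exact ⟨⟨x, hx⟩, fun heq => hne (by rw [← hσ ⟨x, hx⟩, heq]), rfl⟩
    · rintro ⟨y, hy, rfl⟩
      exact ⟨y.2, fun heq => hy (Subtype.ext ((hσ y).trans heq))⟩
  constructor
  · rintro ⟨σ, hfin, hσ⟩
    rw [key σ hσ]
    exact Set.Finite.image _ hfin
  · intro hfin
    obtain ⟨σ, hσ⟩ := exists_inducesPerm h
    rw [key σ hσ] at hfin
    exact ⟨σ, hfin.of_finite_image Subtype.val_injective.injOn, hσ⟩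

theorem isProperNormal_finHomeo (α : Ordinal.{u}) : IsProperNormal (finHomeo α) := by
  refine ⟨⟨fun h hh g => ?_⟩, fun htop => ?_⟩
  · rw [mem_finHomeo_iff] at hh ⊢
    refine (hh.image g).subset ?_
    rintro x ⟨hx, hne⟩
    refine ⟨g⁻¹ x, ⟨homeo_mem_maxRank _ hx, fun heq => hne ?_⟩, g.apply_symm_apply x⟩
    rw [Homeomorph.mul_apply, Homeomorph.mul_apply, heq]
    exact g.apply_symm_apply x
  · obtain ⟨g, hg⟩ := (isLayered_maxRank α).exists_infinite_moved
    exact hg (mem_finHomeo_iff.1 (htop ▸ Subgroup.mem_top g))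

theorem IsProperNormal.le_finHomeo {N : Subgroup (HomeoOmegaPow α)} (hN : IsProperNormal N) :
    N ≤ finHomeo α := by
  intro h hh
  rw [mem_finHomeo_iff]
  by_contra hinf
  have := hN.1
  exact hN.2 ((isLayered_maxRank α).eq_top_of_infinite_moved hh hinf)

/-- The identification of the natural numbers with the ordinals below `ω`. -/
noncomputable def natEquivOmegaPowZero : ℕ ≃ OmegaPow (0 : Ordinal.{u}) :=
  Equiv.ofBijective (fun n => ⟨n, by simp⟩) ⟨fun a b h => by simpa using h, fun x => by
    obtain ⟨n, hn⟩ := lt_omega0.1 (by simpa using x.2 : (x : Ordinal.{u}) < ω)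
    exact ⟨n, Subtype.ext hn.symm⟩⟩

theorem coe_natEquivOmegaPowZero (n : ℕ) :
    (natEquivOmegaPowZero.{u} n : Ordinal.{u}) = n := rfl

/-- The identification of `Homeo(ω)` with `Sym(ℕ)`. -/
noncomputable def homeoOmegaPowZeroEquiv : HomeoOmegaPow (0 : Ordinal.{u}) ≃* Equiv.Perm ℕ where
  toFun h := (natEquivOmegaPowZero.trans h.toEquiv).trans natEquivOmegaPowZero.symm
  invFun σ := ((natEquivOmegaPowZero.symm.trans σ).trans
    natEquivOmegaPowZero).toHomeomorphOfDiscrete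
  left_inv h := by
    ext1 x
    change natEquivOmegaPowZero (natEquivOmegaPowZero.symm
      (h (natEquivOmegaPowZero (natEquivOmegaPowZero.symm x)))) = h x
    simp
  right_inv σ := by
    ext n
    change natEquivOmegaPowZero.symm (natEquivOmegaPowZero
      (σ (natEquivOmegaPowZero.symm (natEquivOmegaPowZero n)))) = σ n
    simp
  map_mul' g h := by
    ext n
    simp

theorem natEquivOmegaPowZero_homeoOmegaPowZeroEquiv (h : HomeoOmegaPow (0 : Ordinal.{u}))
    (n : ℕ) :
    natEquivOmegaPowZero (homeoOmegaPowZeroEquiv h n) = h (natEquivOmegaPowZero n) := by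
  simp [homeoOmegaPowZeroEquiv]

theorem coe_homeo_apply (h : HomeoOmegaPow (0 : Ordinal.{u})) (x : OmegaPow (0 : Ordinal.{u}))
    (n : ℕ) (hx : (x : Ordinal.{u}) = n) :
    (h x : Ordinal.{u}) = (homeoOmegaPowZeroEquiv h n : ℕ) := by
  obtain rfl : x = natEquivOmegaPowZero n := Subtype.ext hx
  rw [← natEquivOmegaPowZero_homeoOmegaPowZeroEquiv, coe_natEquivOmegaPowZero]

theorem homeoOmegaPowZeroEquiv_mem_finPerm_iff (h : HomeoOmegaPow (0 : Ordinal.{u})) :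
    homeoOmegaPowZeroEquiv h ∈ finPerm ℕ ↔ h ∈ finHomeo 0 := by
  have : {x ∈ maxRank (0 : Ordinal.{u}) | h x ≠ x} =
      natEquivOmegaPowZero '' {n | homeoOmegaPowZeroEquiv h n ≠ n} := by
    ext x
    obtain ⟨n, rfl⟩ := natEquivOmegaPowZero.surjective x
    simp [maxRank_zero, ← natEquivOmegaPowZero_homeoOmegaPowZeroEquiv]
  rw [mem_finHomeo_iff, this, Set.finite_image_iff natEquivOmegaPowZero.injective.injOn]
  rfl

theorem map_finHomeo_zero :
    (finHomeo (0 : Ordinal.{u})).map homeoOmegaPowZeroEquiv.toMonoidHom = finPerm ℕ := by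
  ext σ
  constructor
  · rintro ⟨h, hh, rfl⟩
    exact (homeoOmegaPowZeroEquiv_mem_finPerm_iff h).2 hh
  · intro hσ
    obtain ⟨h, rfl⟩ := homeoOmegaPowZeroEquiv.{u}.surjective σ
    exact ⟨h, (homeoOmegaPowZeroEquiv_mem_finPerm_iff h).1 hσ, rfl⟩

theorem isProperNormal_finPerm : IsProperNormal (finPerm ℕ) := by
  rw [← map_finHomeo_zero.{0}]
  exact (isProperNormal_finHomeo 0).map_equiv _

theorem IsProperNormal.le_finPerm {N : Subgroup (Equiv.Perm ℕ)} (hN : IsProperNormal N) :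
    N ≤ finPerm ℕ := by
  intro σ hσ
  -- The statement for ℕ is pulled back to ω, where it is the case α = 0.
  have hle := (hN.map_equiv homeoOmegaPowZeroEquiv.{0}.symm).le_finHomeo
  have := (homeoOmegaPowZeroEquiv_mem_finPerm_iff _).2 (hle ⟨σ, hσ, rfl⟩)
  simpa using this

end Largest


theorem mainTheorem2 :
    (∀ α : Ordinal.{u},
      -- every homeomorphism induces a permutation of the maximal rank elements
      (∀ h : HomeoOmegaPow α, ∃ σ : Equiv.Perm (maxRank α), InducesPerm h (maxRank α) σ) ∧
      -- the finite ones form a proper normal subgroup that contains every proper normal subgroup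
      IsProperNormal (finHomeo α) ∧
      (∀ N : Subgroup (HomeoOmegaPow α), IsProperNormal N → N ≤ finHomeo α) ∧
      -- so that it is the unique maximal proper normal subgroup
      (∀ N : Subgroup (HomeoOmegaPow α), Maximal IsProperNormal N ↔ N = finHomeo α)) ∧
    -- the case `α = 0`: under the identification of `Homeo(ω)` with `Sym(ℕ)` the subgroup becomes
    -- the group of finite permutations, which has the same property
    (∃ e : HomeoOmegaPow (0 : Ordinal.{u}) ≃* Equiv.Perm ℕ,
      (∀ (h : HomeoOmegaPow (0 : Ordinal.{u})) (x : OmegaPow (0 : Ordinal.{u})) (n : ℕ),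
        (x : Ordinal.{u}) = n → (h x : Ordinal.{u}) = (e h n : ℕ)) ∧
      (finHomeo (0 : Ordinal.{u})).map e.toMonoidHom = finPerm ℕ) ∧
    IsProperNormal (finPerm ℕ) ∧
    (∀ N : Subgroup (Equiv.Perm ℕ), IsProperNormal N → N ≤ finPerm ℕ) ∧
    (∀ N : Subgroup (Equiv.Perm ℕ), Maximal IsProperNormal N ↔ N = finPerm ℕ) := by
  exact ⟨fun α => ⟨exists_inducesPerm, isProperNormal_finHomeo α, fun _ hN => hN.le_finHomeo,
      maximal_isProperNormal_iff (isProperNormal_finHomeo α) fun _ hN => hN.le_finHomeo⟩,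
    ⟨homeoOmegaPowZeroEquiv, coe_homeo_apply, map_finHomeo_zero⟩, isProperNormal_finPerm,
    fun _ hN => hN.le_finPerm,
    maximal_isProperNormal_iff isProperNormal_finPerm fun _ hN => hN.le_finPerm⟩
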